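/- \textbf{Setting.} Let $\mathcal X=\{0,1\}$ with addition modulo $2$, and let all block lengths be powers of two, $n=2^i$, $i\ge 0$. The polar generator matrices over $\mathbb F_2$ are defined by $G_1=I_1$ and $G_n=(I_{n/2}\otimes F)\,R_n\,(I_2\otimes G_{n/2})$, where $F=\begin{pmatrix}1&0\\1&1\end{pmatrix}$ and $R_n$ is the reverse shuffle, $(s_1,\dots,s_n)R_n=(s_1,s_3,\dots,s_{n-1},s_2,s_4,\dots,s_n)$. For $S\subseteq[n]$ let $G_n(S)$ be the submatrix of the rows of $G_n$ with index in $S$. For a memoryless channel $p(y|x)$ with input alphabet $\mathcal X$ and finite output alphabet $\mathcal Y$, put $p(\mathbf y|\mathbf x)=\prod_k p(y_k|x_k)$ and $p_n(\mathbf y|\mathbf w)=p(\mathbf y|\mathbf wG_n)$. For $l\in[n]$ the split channel is $$p_n^{(l)}(\mathbf y,\mathbf w|x)=\frac1{2^{n-1}}\sum_{\mathbf c\in\mathcal X^{n-l}}p_n\bigl(\mathbf y|(\mathbf w,x,\mathbf c)\bigr),\qquad \mathbf w\in\mathcal X^{l-1},\ x\in\mathcal X,$$ and its Bhattacharyya parameter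 is $B(p_n^{(l)})=\sum_{\mathbf y,\mathbf w}\sqrt{p_n^{(l)}(\mathbf y,\mathbf w|0)\,p_n^{(l)}(\mathbf y,\mathbf w|1)}$. Consider the wiretap channel whose channel to the legitimate user is noiseless and whose channel $Q$ to the eavesdropper is the binary erasure channel with erasure probability $\delta\in[0,1]$. Given $\mathcal N_n\subseteq[n]$, put $\mathcal A_n=[n]\setminus\mathcal N_n$ (so that there are no fixed bits). The polar coset scheme draws a message $\mathbf U\in\mathcal X^{|\mathcal A_n|}$ and, independently of it, random bits $\mathbf b^*\in\mathcal X^{|\mathcal N_n|}$, both uniformly distributed, and sends $\mathbf X=\mathbf U\,G_n(\mathcal A_n)+\mathbf b^*G_n(\mathcal N_n)$ over the memoryless wiretap channel; let $\mathbf Z$ be the eavesdropper's received vector. Entropies are in bits. \textbf{Lemma.} For every $\delta\in[0,1]$ there is a constant $c>0$, depending only on $\delta$, such that the following holds for every $\beta\in(0,\tfrac12)$ and every block length $n=2^i$. If $\mathcal N_n\subseteq[n]$ consists of indices that are good for the eavesdropper, that is, $B(Q_n^{(l)})\le 2^{-n^\beta}$ for all $l\in\mathcal N_n$, then $$H(\mathbf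 U|\mathbf Z)\ \ge\ n\,\delta\,\bigl(1-c\,2^{-n^\beta}\bigr).$$ -/

import Mathlib

namespace PolarWiretap

/-- The binary alphabet `{0, 1}`, with addition modulo 2. -/
abbrev Bit : Type := ZMod 2

/-! ### The polar generator matrix -/

/-- The kernel `F`. -/
def polarKernel : Matrix (Fin 2) (Fin 2) Bit := !![1, 0; 1, 1]

/-- The Kronecker product of two square matrices with the usual (block) numbering of rows and
columns, for a product size that is propositionally equal to `n`. -/
def finKronecker {a b n : ℕ} (h : a * b = n)
    (A : Matrix (Fin a) (Fin a) Bit) (B : Matrix (Fin b) (Fin b) Bit) :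
    Matrix (Fin n) (Fin n) Bit :=
  (Matrix.kroneckerMap (fun x y => x * y) A B).reindex
    (finProdFinEquiv.trans (finCongr h)) (finProdFinEquiv.trans (finCongr h))

/-- The reverse shuffle operator `R_n` for `n = 2 m`: in `v = s R_n` the first half of `v` lists the
entries of `s` at the positions `1, 3, 5, …`, the second half those at the positions `2, 4, 6, …`
(positions numbered from one; the indices in the code start at zero). -/
def reverseShuffle (m n : ℕ) : Matrix (Fin n) (Fin n) Bit :=
  Matrix.of fun j k =>
    if j.val = (if k.val < m then 2 * k.val else 2 * (k.val - m) + 1) then 1 else 0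

/-- The polar generator matrix `G_n`, `n = 2 ^ i`:
`G_1 = I_1` and `G_n = (I_{n/2} ⊗ F) R_n (I_2 ⊗ G_{n/2})`. -/
def polarG : (i : ℕ) → Matrix (Fin (2 ^ i)) (Fin (2 ^ i)) Bit
  | 0 => 1
  | i + 1 =>
      finKronecker (pow_succ 2 i).symm (1 : Matrix (Fin (2 ^ i)) (Fin (2 ^ i)) Bit) polarKernel *
        reverseShuffle (2 ^ i) (2 ^ (i + 1)) *
        finKronecker (pow_succ' 2 i).symm (1 : Matrix (Fin 2) (Fin 2) Bit) (polarG i)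

/-- The submatrix `G_n(S)` formed by the rows of `G_n` whose indices lie in `S`. -/
def polarRows (i : ℕ) (S : Finset (Fin (2 ^ i))) : Matrix S (Fin (2 ^ i)) Bit :=
  (polarG i).submatrix Subtype.val id

/-! ### Binary-input memoryless channels, combined and split channels

A channel with input alphabet `Bit` and output alphabet `𝒴` is given by its transition
probabilities `p x y` (the probability of the output `y` given the input `x`). -/

section Channels

variable {𝒴 : Type*} [Fintype 𝒴]

/-- Block transition probabilities `p(𝐲 | 𝐱) = ∏ₖ p(yₖ | xₖ)`. -/
def blockProb (p : Bit → 𝒴 → ℝ) {n : ℕ} (x : Fin n → Bit) (y : Fin n → 𝒴) : ℝ :=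
  ∏ k, p (x k) (y k)

/-- The combined channel `p_n(𝐲 | 𝐰) = p(𝐲 | 𝐰 G_n)`, `n = 2 ^ i`. -/
def combinedChannel (p : Bit → 𝒴 → ℝ) (i : ℕ) (w : Fin (2 ^ i) → Bit) (y : Fin (2 ^ i) → 𝒴) : ℝ :=
  blockProb p (Matrix.vecMul w (polarG i)) y

/-- The split channel of the index `l`,
`p_n^{(l)}(𝐲, 𝐰 | x) = 2^{-(n-1)} ∑_𝐜 p_n(𝐲 | (𝐰, x, 𝐜))`, where `𝐰` consists of the entries that
precede `l`: the sum is over all input vectors `v` that begin with `(𝐰, x)`. -/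
noncomputable def splitChannel (p : Bit → 𝒴 → ℝ) (i : ℕ) (l : Fin (2 ^ i)) (x : Bit)
    (y : Fin (2 ^ i) → 𝒴) (w : Fin l.val → Bit) : ℝ :=
  1 / 2 ^ (2 ^ i - 1) *
    ∑ v : Fin (2 ^ i) → Bit with (∀ j : Fin l.val, v (Fin.castLE l.isLt.le j) = w j) ∧ v l = x,
      combinedChannel p i v y

/-- The Bhattacharyya parameter `B(p_n^{(l)})` of the split channel of the index `l`. -/
noncomputable def bhattacharyya (p : Bit → 𝒴 → ℝ) (i : ℕ) (l : Fin (2 ^ i)) : ℝ :=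
  ∑ y : Fin (2 ^ i) → 𝒴, ∑ w : Fin l.val → Bit,
    √(splitChannel p i l 0 y w * splitChannel p i l 1 y w)

end Channels

/-! ### The binary erasure wiretap channel -/

/-- The binary erasure channel with erasure probability `δ`; the output `none` is the erasure. -/
def bec (δ : ℝ) (x : Bit) : Option Bit → ℝ
  | none => δ
  | some z => if z = x then 1 - δ else 0

/-- The wiretap channel `P(y, z | x)` with a noiseless channel to the legitimate user
(`y = x`) and a binary erasure channel with erasure probability `δ` to the eavesdropper. -/
def erasureWiretap (δ : ℝ) (x : Bit) : Bit × Option Bit → ℝ :=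
  fun yz => if yz.1 = x then bec δ x yz.2 else 0

/-- The marginal channel `Q(z | x)` to the eavesdropper. -/
def eavesdropper {𝒴 𝒵 : Type*} [Fintype 𝒴] (P : Bit → 𝒴 × 𝒵 → ℝ) (x : Bit) (z : 𝒵) : ℝ :=
  ∑ y, P x (y, z)

/-! ### The polar coset scheme and the equivocation -/

/-- The transmitted codeword `𝐱 = 𝐮 G_n(A) + 𝐛* G_n(N)` (without fixed bits). -/
def codeword (i : ℕ) (A N : Finset (Fin (2 ^ i))) (u : A → Bit) (b : N → Bit) : Fin (2 ^ i) → Bit :=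
  Matrix.vecMul u (polarRows i A) + Matrix.vecMul b (polarRows i N)

/-- The joint law of `(𝐔, 𝐛*, 𝐘, 𝐙)`: the message `𝐔` and the random bits `𝐛*` are independent and
uniformly distributed, and the codeword is sent over the memoryless wiretap channel `P`. -/
noncomputable def schemeLaw {𝒴 𝒵 : Type*} [Fintype 𝒴] [Fintype 𝒵] (P : Bit → 𝒴 × 𝒵 → ℝ) (i : ℕ)
    (A N : Finset (Fin (2 ^ i))) (u : A → Bit) (b : N → Bit)
    (y : Fin (2 ^ i) → 𝒴) (z : Fin (2 ^ i) → 𝒵) : ℝ :=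
  (1 / 2 ^ A.card) * (1 / 2 ^ N.card) *
    blockProb P (codeword i A N u b) (fun k => (y k, z k))

/-- The joint law of the message `𝐔` and the eavesdropper's observation `𝐙`. -/
noncomputable def messageObservationLaw {𝒴 𝒵 : Type*} [Fintype 𝒴] [Fintype 𝒵]
    (P : Bit → 𝒴 × 𝒵 → ℝ) (i : ℕ) (A N : Finset (Fin (2 ^ i)))
    (u : A → Bit) (z : Fin (2 ^ i) → 𝒵) : ℝ :=
  ∑ b : N → Bit, ∑ y : Fin (2 ^ i) → 𝒴, schemeLaw P i A N u b y z

/-- The conditional Shannon entropy `H(U | Z)` in bits, for a pair of finite random variables with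
the joint law `p u z`. -/
noncomputable def condEntropy {α γ : Type*} [Fintype α] [Fintype γ] (p : α → γ → ℝ) : ℝ :=
  -∑ z, ∑ u, p u z * Real.logb 2 (p u z / ∑ u', p u' z)

/-- The equivocation `H(𝐔 | 𝐙)` of the polar coset scheme with information set `A`, random bits at
the indices in `N` and no fixed bits, used over the wiretap channel `P`. -/
noncomputable def equivocation {𝒴 𝒵 : Type*} [Fintype 𝒴] [Fintype 𝒵]
    (P : Bit → 𝒴 × 𝒵 → ℝ) (i : ℕ) (A N : Finset (Fin (2 ^ i))) : ℝ :=
  condEntropy (messageObservationLaw P i A N)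

end PolarWiretap

/-! Erasures turn likelihoods into counting (`blockProb_bec`). Let `z` have `e` erasures. As `G_n`
is invertible, exactly `2 ^ e` inputs are consistent with `z`, all equally likely. Given the message
as well, decode the random bits in order: a bit is left open only at an ambiguous index, so at most
`2 ^ a` choices survive, where `a` counts the ambiguous indices in `N` (`card_consistent_merge_le`).
Every posterior probability of the message is thus at most `2 ^ (a - e)`, and `H(U|Z) ≥ E[e] - E[a]`
(`le_condEntropy`).

Here `E[e] = nδ`, and an index is ambiguous with probability at most its Bhattacharyya parameter
(`sum_outputLaw_ambiguous_le`), so `E[a] ≤ n 2 ^ (-n ^ β)`. Dividing by `nδ` gives `c = 1 / δ`. -/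

namespace PolarWiretap

open Finset

/-! ### Invertibility of the polar generator matrix -/

theorem isUnit_det_finKronecker {a b n : ℕ} (h : a * b = n)
    {A : Matrix (Fin a) (Fin a) Bit} {B : Matrix (Fin b) (Fin b) Bit}
    (hA : IsUnit A.det) (hB : IsUnit B.det) : IsUnit (finKronecker h A B).det := by
  unfold finKronecker
  rw [Matrix.det_reindex_self]
  have := Matrix.det_kronecker A B
  rw [this]
  exact (hA.pow _).mul (hB.pow _)

theorem isUnit_det_reverseShuffle {m n : ℕ} (h : n = 2 * m) :
    IsUnit (reverseShuffle m n).det := by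
  let f : Fin n → Fin n := fun k =>
    ⟨if k.val < m then 2 * k.val else 2 * (k.val - m) + 1, by have := k.isLt; split_ifs <;> omega⟩
  have hf : Function.Injective f := by
    intro j k hjk
    have := congrArg Fin.val hjk
    simp only [f] at this
    ext
    split_ifs at this <;> omega
  let σ : Equiv.Perm (Fin n) := Equiv.ofBijective f (Finite.injective_iff_bijective.mp hf)
  have hR : reverseShuffle m n = (1 : Matrix (Fin n) (Fin n) Bit).submatrix id σ := by
    ext j k
    simp [reverseShuffle, Matrix.one_apply, σ, f, Fin.ext_iff]
  rw [hR, Matrix.det_permute']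
  rcases Int.units_eq_one_or (Equiv.Perm.sign σ) with hs | hs <;> simp [hs]

theorem isUnit_det_polarG (i : ℕ) : IsUnit (polarG i).det := by
  induction i with
  | zero => simp [polarG]
  | succ i ih =>
    rw [polarG, Matrix.det_mul, Matrix.det_mul]
    refine ((isUnit_det_finKronecker _ (by simp) ?_).mul
      (isUnit_det_reverseShuffle (pow_succ' 2 i))).mul (isUnit_det_finKronecker _ (by simp) ih)
    simp [polarKernel, Matrix.det_fin_two]

theorem bijective_vecMul_polarG (i : ℕ) :
    Function.Bijective fun w : Fin (2 ^ i) → Bit => Matrix.vecMul w (polarG i) :=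
  Finite.injective_iff_bijective.mp <| Matrix.vecMul_injective_of_isUnit <|
    (Matrix.isUnit_iff_isUnit_det _).mpr (isUnit_det_polarG i)

/-! ### The erasure channel -/

theorem eavesdropper_erasureWiretap (δ : ℝ) : eavesdropper (erasureWiretap δ) = bec δ := by
  funext x z
  simp [eavesdropper, erasureWiretap]

theorem sum_bec (δ : ℝ) (x : Bit) : ∑ z, bec δ x z = 1 := by
  simp [Fintype.sum_option, bec]

theorem bec_nonneg {δ : ℝ} (hδ0 : 0 ≤ δ) (hδ1 : δ ≤ 1) (x : Bit) (z : Option Bit) :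
    0 ≤ bec δ x z := by
  rcases z with _ | z
  · exact hδ0
  · simp only [bec]
    split_ifs <;> linarith

/-- The input `x` could have produced the erasure channel output `z`. -/
def Consistent {n : ℕ} (x : Fin n → Bit) (z : Fin n → Option Bit) : Prop :=
  ∀ k, z k = none ∨ z k = some (x k)

instance {n : ℕ} (x : Fin n → Bit) (z : Fin n → Option Bit) : Decidable (Consistent x z) := by
  unfold Consistent
  infer_instance

/-- The set of erased positions. -/
def erased {n : ℕ} (z : Fin n → Option Bit) : Finset (Fin n) := {k | z k = none}

/-- The probability of the erasure pattern of `z`. -/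
def patternProb (δ : ℝ) {n : ℕ} (z : Fin n → Option Bit) : ℝ :=
  ∏ k, if z k = none then δ else 1 - δ

theorem patternProb_nonneg {δ : ℝ} (hδ0 : 0 ≤ δ) (hδ1 : δ ≤ 1) {n : ℕ}
    (z : Fin n → Option Bit) : 0 ≤ patternProb δ z :=
  prod_nonneg fun k _ => by split_ifs <;> linarith

theorem blockProb_bec (δ : ℝ) {n : ℕ} (x : Fin n → Bit) (z : Fin n → Option Bit) :
    blockProb (bec δ) x z = if Consistent x z then patternProb δ z else 0 := by
  unfold blockProb patternProb
  split_ifs with h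
  · refine prod_congr rfl fun k _ => ?_
    rcases h k with hk | hk <;> simp [hk, bec]
  · unfold Consistent at h
    push Not at h
    obtain ⟨k, hk, hk'⟩ := h
    refine prod_eq_zero (mem_univ k) ?_
    obtain ⟨b, hb⟩ := Option.ne_none_iff_exists'.mp hk
    have : b ≠ x k := fun h => hk' (by rw [hb, h])
    simp [hb, bec, this]

theorem sum_blockProb_erasureWiretap (δ : ℝ) {n : ℕ} (x : Fin n → Bit)
    (z : Fin n → Option Bit) :
    ∑ y : Fin n → Bit, blockProb (erasureWiretap δ) x (fun k => (y k, z k)) =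
      blockProb (bec δ) x z := by
  rw [← eavesdropper_erasureWiretap]
  unfold blockProb eavesdropper
  rw [Fintype.prod_sum]

theorem sum_blockProb_bec_erased (δ : ℝ) {n : ℕ} (x : Fin n → Bit) :
    ∑ z : Fin n → Option Bit, blockProb (bec δ) x z * (erased z).card = n * δ := by
  have key : ∀ k : Fin n,
      ∑ z : Fin n → Option Bit, blockProb (bec δ) x z * (if z k = none then 1 else 0) = δ := by
    intro k
    -- Absorbing the indicator into the factor at `k` makes the sum over `z` factorise; all other
    -- factors sum to 1.
    have h1 : ∀ z : Fin n → Option Bit,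
        blockProb (bec δ) x z * (if z k = none then 1 else 0) =
          ∏ j, bec δ (x j) (z j) * (if j = k then (if z j = none then 1 else 0) else 1) := by
      intro z
      rw [prod_mul_distrib, prod_ite_eq' univ k (fun j => if z j = none then (1 : ℝ) else 0)]
      simp [blockProb]
    simp_rw [h1]
    rw [← Fintype.prod_sum
      (f := fun j s => bec δ (x j) s * (if j = k then (if s = none then (1 : ℝ) else 0) else 1)),
      prod_eq_single k]
    · simp [bec]
    · intro j _ hj
      simpa [hj] using sum_bec δ (x j)
    · simp
  have h2 : ∀ z : Fin n → Option Bit,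
      ((erased z).card : ℝ) = ∑ k, if z k = none then (1 : ℝ) else 0 := by
    intro z
    simp [erased]
  simp_rw [h2, mul_sum]
  rw [sum_comm]
  simp_rw [key]
  simp

theorem card_consistent {n : ℕ} (z : Fin n → Option Bit) :
    #{x : Fin n → Bit | Consistent x z} = 2 ^ (erased z).card := by
  have : ({x : Fin n → Bit | Consistent x z} : Finset _) =
      Fintype.piFinset fun k => ({b | z k = none ∨ z k = some b} : Finset Bit) := by
    ext x
    rw [mem_filter, Fintype.mem_piFinset]
    simp only [mem_univ, true_and, mem_filter]
    rfl
  rw [this, Fintype.card_piFinset, erased, ← prod_const, prod_filter]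
  refine prod_congr rfl fun k _ => ?_
  rcases z k with _ | b
  · simp [ZMod.card]
  · simp [filter_eq]

theorem Consistent.sub_eq_zero {n : ℕ} {x x' : Fin n → Bit} {z : Fin n → Option Bit}
    (h : Consistent x z) (h' : Consistent x' z) {k : Fin n} (hk : z k ≠ none) :
    (x - x') k = 0 := by
  have h1 := (h k).resolve_left hk
  have h2 := (h' k).resolve_left hk
  rw [h1] at h2
  simp [Option.some.inj h2]

theorem consistent_add_iff {n : ℕ} {d : Fin n → Bit} {z : Fin n → Option Bit}
    (hd : ∀ k, z k ≠ none → d k = 0) (x : Fin n → Bit) :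
    Consistent (x + d) z ↔ Consistent x z := by
  refine forall_congr' fun k => ?_
  by_cases hk : z k = none
  · simp [hk]
  · simp [hd k hk]

/-! ### Ambiguous indices -/

/-- Given the erasure pattern of `z` and all earlier input bits, the input bit `l` is not
determined: some input vector with leading entry `l` produces zeros at all unerased positions. -/
def Ambiguous (i : ℕ) (l : Fin (2 ^ i)) (z : Fin (2 ^ i) → Option Bit) : Prop :=
  ∃ v : Fin (2 ^ i) → Bit, (∀ j < l, v j = 0) ∧ v l = 1 ∧
    ∀ k, z k ≠ none → Matrix.vecMul v (polarG i) k = 0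

/-- The law of the eavesdropper's observation under a uniformly distributed input. -/
noncomputable def outputLaw (δ : ℝ) (i : ℕ) (z : Fin (2 ^ i) → Option Bit) : ℝ :=
  1 / 2 ^ 2 ^ i * ∑ w : Fin (2 ^ i) → Bit, blockProb (bec δ) (Matrix.vecMul w (polarG i)) z

/-- Invertibility of `G_n` makes the codeword uniform, so the sum counts the words consistent with
`z`. -/
theorem outputLaw_eq (δ : ℝ) (i : ℕ) (z : Fin (2 ^ i) → Option Bit) :
    outputLaw δ i z = 1 / 2 ^ 2 ^ i * (patternProb δ z * 2 ^ (erased z).card) := by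
  unfold outputLaw
  rw [(bijective_vecMul_polarG i).sum_comp fun x => blockProb (bec δ) x z]
  simp_rw [blockProb_bec]
  rw [← sum_filter, sum_const, card_consistent, nsmul_eq_mul]
  push_cast
  ring

theorem sum_outputLaw_mul_erased (δ : ℝ) (i : ℕ) :
    ∑ z, outputLaw δ i z * (erased z).card = ((2 ^ i : ℕ) : ℝ) * δ := by
  simp_rw [outputLaw, mul_assoc, sum_mul]
  rw [← mul_sum, sum_comm]
  simp_rw [sum_blockProb_bec_erased]
  rw [sum_const, card_univ, nsmul_eq_mul]
  simp [ZMod.card]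

/-- For an ambiguous index, both values of the input bit are equally likely. -/
theorem Ambiguous.splitChannel_eq {i : ℕ} {l : Fin (2 ^ i)} {z : Fin (2 ^ i) → Option Bit}
    (h : Ambiguous i l z) (δ : ℝ) (w : Fin l.val → Bit) :
    splitChannel (bec δ) i l 0 z w = splitChannel (bec δ) i l 1 z w := by
  obtain ⟨v, hv0, hv1, hvK⟩ := h
  have hlt : ∀ j : Fin l.val, v (Fin.castLE l.isLt.le j) = 0 := fun j => hv0 _ j.isLt
  unfold splitChannel
  congr 1
  -- Translation by the witness keeps the prefix, flips bit `l` and changes the codeword only at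
  -- erased positions.
  refine sum_equiv (Equiv.addRight v) ?_ ?_
  · intro a
    simp only [mem_filter, mem_univ, true_and, Equiv.coe_addRight, Pi.add_apply, hlt, add_zero,
      hv1, add_eq_right]
  · intro a _
    simp only [combinedChannel, blockProb_bec, Equiv.coe_addRight, Matrix.add_vecMul,
      consistent_add_iff hvK]

theorem splitChannel_bec_nonneg {δ : ℝ} (hδ0 : 0 ≤ δ) (hδ1 : δ ≤ 1) (i : ℕ) (l : Fin (2 ^ i))
    (x : Bit) (z : Fin (2 ^ i) → Option Bit) (w : Fin l.val → Bit) :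
    0 ≤ splitChannel (bec δ) i l x z w :=
  mul_nonneg (by positivity) <| sum_nonneg fun _ _ => by
    unfold combinedChannel blockProb
    exact prod_nonneg fun _ _ => bec_nonneg hδ0 hδ1 _ _

/-- Prefix and bit `l` together cover every input once; the 2 comes from normalising by `2 ^ (n -
1)` instead of `2 ^ n`. -/
theorem sum_splitChannel_bec (δ : ℝ) (i : ℕ) (l : Fin (2 ^ i)) (z : Fin (2 ^ i) → Option Bit) :
    ∑ w : Fin l.val → Bit, (splitChannel (bec δ) i l 0 z w + splitChannel (bec δ) i l 1 z w) =
      2 * outputLaw δ i z := by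
  have h1 : ∀ w, splitChannel (bec δ) i l 0 z w + splitChannel (bec δ) i l 1 z w =
      1 / 2 ^ (2 ^ i - 1) * ∑ v : Fin (2 ^ i) → Bit with
        (fun j : Fin l.val => v (Fin.castLE l.isLt.le j)) = w, combinedChannel (bec δ) i v z := by
    intro w
    have h2 : ∀ v : Fin (2 ^ i) → Bit, ¬ v l = 0 ↔ v l = 1 := fun v => by
      generalize v l = b
      revert b
      decide
    rw [← sum_filter_add_sum_filter_not _ (fun v => v l = 0)]
    simp only [splitChannel, filter_filter, funext_iff, h2, mul_add]
  simp_rw [h1]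
  rw [← mul_sum, sum_fiberwise]
  have h3 : (2 : ℝ) ^ 2 ^ i = 2 * 2 ^ (2 ^ i - 1) := by
    rw [← pow_succ', Nat.sub_add_cancel Nat.one_le_two_pow]
  unfold outputLaw combinedChannel
  rw [h3]
  field_simp

open Classical in
-- On an ambiguous `z` the two likelihoods agree, so their geometric mean is their average, which
-- sums to `outputLaw`. The remaining terms are nonnegative.
theorem sum_outputLaw_ambiguous_le {δ : ℝ} (hδ0 : 0 ≤ δ) (hδ1 : δ ≤ 1) (i : ℕ)
    (l : Fin (2 ^ i)) :
    ∑ z, outputLaw δ i z * (if Ambiguous i l z then 1 else 0) ≤ bhattacharyya (bec δ) i l := by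
  refine sum_le_sum fun z _ => ?_
  split_ifs with h
  · have h1 := sum_splitChannel_bec δ i l z
    simp_rw [h.splitChannel_eq δ, ← two_mul, ← mul_sum] at h1
    simp_rw [h.splitChannel_eq δ, Real.sqrt_mul_self (splitChannel_bec_nonneg hδ0 hδ1 i l 1 z _)]
    linarith
  · rw [mul_zero]
    exact sum_nonneg fun _ _ => Real.sqrt_nonneg _

/-! ### The law of message and observation -/

/-- The input vector of the polar transform made of the message and the random bits. -/
def merge {i : ℕ} (N : Finset (Fin (2 ^ i))) (u : ↥(univ \ N) → Bit) (b : N → Bit) :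
    Fin (2 ^ i) → Bit :=
  fun j => if h : j ∈ N then b ⟨j, h⟩ else u ⟨j, by simp [h]⟩

theorem codeword_eq_vecMul_merge {i : ℕ} (N : Finset (Fin (2 ^ i))) (u : ↥(univ \ N) → Bit)
    (b : N → Bit) :
    codeword i (univ \ N) N u b = Matrix.vecMul (merge N u b) (polarG i) := by
  funext k
  simp only [codeword, Pi.add_apply, Matrix.vecMul, dotProduct, polarRows, Matrix.submatrix_apply,
    id]
  rw [← sum_sdiff (subset_univ N), ← sum_coe_sort (univ \ N), ← sum_coe_sort N]
  congr 1
  · refine sum_congr rfl fun j _ => ?_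
    have := (mem_sdiff.mp j.2).2
    simp [merge, this]
  · refine sum_congr rfl fun j _ => ?_
    simp [merge]

theorem sum_merge {i : ℕ} (N : Finset (Fin (2 ^ i))) (f : (Fin (2 ^ i) → Bit) → ℝ) :
    ∑ u, ∑ b, f (merge N u b) = ∑ w, f w := by
  rw [← Fintype.sum_prod_type']
  refine Function.Bijective.sum_comp
    (e := fun ub : (↥(univ \ N) → Bit) × (N → Bit) => merge N ub.1 ub.2) ⟨?_, ?_⟩ f
  · rintro ⟨u, b⟩ ⟨u', b'⟩ h
    have h' := fun j => congrFun h j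
    refine Prod.ext (funext fun j => ?_) (funext fun j => ?_)
    · have := (mem_sdiff.mp j.2).2
      simpa [merge, this] using h' j
    · simpa [merge] using h' j
  · intro w
    refine ⟨(fun j => w j, fun j => w j), ?_⟩
    funext j
    simp [merge]

theorem messageObservationLaw_eq_sum (δ : ℝ) {i : ℕ} (N : Finset (Fin (2 ^ i)))
    (u : ↥(univ \ N) → Bit) (z : Fin (2 ^ i) → Option Bit) :
    messageObservationLaw (erasureWiretap δ) i (univ \ N) N u z =
      1 / 2 ^ 2 ^ i *
        ∑ b, blockProb (bec δ) (Matrix.vecMul (merge N u b) (polarG i)) z := by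
  have h : (univ \ N).card + N.card = 2 ^ i := by
    rw [card_sdiff_add_card_eq_card (subset_univ N)]
    simp
  unfold messageObservationLaw schemeLaw
  simp_rw [← mul_sum, sum_blockProb_erasureWiretap, codeword_eq_vecMul_merge]
  rw [one_div_mul_one_div, ← pow_add, h]

theorem sum_messageObservationLaw (δ : ℝ) {i : ℕ} (N : Finset (Fin (2 ^ i)))
    (z : Fin (2 ^ i) → Option Bit) :
    ∑ u, messageObservationLaw (erasureWiretap δ) i (univ \ N) N u z = outputLaw δ i z := by
  simp_rw [messageObservationLaw_eq_sum]
  rw [← mul_sum, sum_merge N fun w => blockProb (bec δ) (Matrix.vecMul w (polarG i)) z]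
  rfl

theorem messageObservationLaw_eq_card (δ : ℝ) {i : ℕ} (N : Finset (Fin (2 ^ i)))
    (u : ↥(univ \ N) → Bit) (z : Fin (2 ^ i) → Option Bit) :
    messageObservationLaw (erasureWiretap δ) i (univ \ N) N u z =
      1 / 2 ^ 2 ^ i * (patternProb δ z *
        #{b : N → Bit | Consistent (Matrix.vecMul (merge N u b) (polarG i)) z}) := by
  rw [messageObservationLaw_eq_sum]
  simp_rw [blockProb_bec]
  rw [← sum_filter, sum_const, nsmul_eq_mul, mul_comm (patternProb δ z)]

theorem messageObservationLaw_nonneg {δ : ℝ} (hδ0 : 0 ≤ δ) (hδ1 : δ ≤ 1) {i : ℕ}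
    (N : Finset (Fin (2 ^ i))) (u : ↥(univ \ N) → Bit) (z : Fin (2 ^ i) → Option Bit) :
    0 ≤ messageObservationLaw (erasureWiretap δ) i (univ \ N) N u z := by
  rw [messageObservationLaw_eq_card]
  have := patternProb_nonneg hδ0 hδ1 z
  positivity

open Classical in
/-- The random bits are determined by the message, the observation and the random bits at the
ambiguous indices. -/
theorem card_consistent_merge_le {i : ℕ} (N : Finset (Fin (2 ^ i))) (u : ↥(univ \ N) → Bit)
    (z : Fin (2 ^ i) → Option Bit) :
    #{b : N → Bit | Consistent (Matrix.vecMul (merge N u b) (polarG i)) z} ≤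
      2 ^ #{l ∈ N | Ambiguous i l z} := by
  set L : Finset (Fin (2 ^ i)) := {l ∈ N | Ambiguous i l z} with hL
  have hLN : ∀ l : L, l.1 ∈ N := fun l => (mem_filter.mp l.2).1
  have hcard : Fintype.card (L → Bit) = 2 ^ #L := by simp [ZMod.card]
  rw [← hcard, ← card_univ]
  refine card_le_card_of_injOn (fun b l => b ⟨l.1, hLN l⟩) (fun _ _ => mem_univ _) ?_
  intro b hb b' hb' hbb
  simp only [coe_filter, mem_univ, true_and, Set.mem_ofPred_eq] at hb hb'
  by_contra hne
  have hD : ({j : Fin (2 ^ i) | merge N u b j ≠ merge N u b' j} : Finset _).Nonempty := by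
    obtain ⟨j, hj⟩ := Function.ne_iff.mp hne
    exact ⟨j, mem_filter.mpr ⟨mem_univ _, by simpa [merge] using hj⟩⟩
  -- At the first disagreement `l`, the difference of the two inputs witnesses that `l` is
  -- ambiguous; but there `b` and `b'` agree by `hbb`.
  set l := min' _ hD with hl
  have hlD := min'_mem _ hD
  rw [← hl, mem_filter] at hlD
  have hlN : l ∈ N := by
    by_contra h
    exact hlD.2 (by simp [merge, h])
  have hamb : Ambiguous i l z := by
    refine ⟨merge N u b - merge N u b', fun j hj => ?_, ?_, fun k hk => ?_⟩
    · by_contra h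
      exact (min'_le _ j (mem_filter.mpr ⟨mem_univ _, fun h' => h (sub_eq_zero.mpr h')⟩)).not_gt hj
    · have h1 : ∀ s t : Bit, s ≠ t → s - t = 1 := by decide
      exact h1 _ _ hlD.2
    · rw [Matrix.sub_vecMul]
      exact hb.sub_eq_zero hb' hk
  have := congrFun hbb ⟨l, mem_filter.mpr ⟨hlN, hamb⟩⟩
  exact hlD.2 (by simpa [merge, hlN] using this)

/-! ### The equivocation -/

/-- Needed only for `δ = 0`. Where `z` has mass zero, the quotient is 0 and so is its logarithm. -/
theorem condEntropy_nonneg {α γ : Type*} [Fintype α] [Fintype γ] {p : α → γ → ℝ}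
    (hp : ∀ u z, 0 ≤ p u z) : 0 ≤ condEntropy p := by
  rw [condEntropy, neg_nonneg]
  refine sum_nonpos fun z _ => sum_nonpos fun u _ => mul_nonpos_of_nonneg_of_nonpos (hp u z) ?_
  have h := sum_nonneg fun u' (_ : u' ∈ univ) => hp u' z
  exact Real.logb_nonpos one_lt_two (div_nonneg (hp u z) h) <|
    div_le_one_of_le₀ (single_le_sum (fun u' _ => hp u' z) (mem_univ u)) h

/-- If all posterior probabilities given `z` are at most `2 ^ (-f z)`, then the conditional entropy
is at least the expectation of `f`. -/
theorem le_condEntropy {α γ : Type*} [Fintype α] [Fintype γ] {p : α → γ → ℝ}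
    (hp : ∀ u z, 0 ≤ p u z) (f : γ → ℝ)
    (hf : ∀ u z, p u z ≤ (∑ u', p u' z) * 2 ^ (-f z)) :
    ∑ z, (∑ u, p u z) * f z ≤ condEntropy p := by
  rw [condEntropy, ← sum_neg_distrib]
  refine sum_le_sum fun z _ => ?_
  rw [sum_mul, ← sum_neg_distrib]
  refine sum_le_sum fun u _ => ?_
  rcases (hp u z).eq_or_lt with h | h
  · simp [← h]
  · have hs : 0 < ∑ u', p u' z := h.trans_le (single_le_sum (fun u' _ => hp u' z) (mem_univ u))
    have : Real.logb 2 (p u z / ∑ u', p u' z) ≤ -f z := by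
      rw [Real.logb_le_iff_le_rpow one_lt_two (div_pos h hs), div_le_iff₀' hs]
      exact hf u z
    nlinarith

theorem le_equivocation {δ : ℝ} (hδ0 : 0 ≤ δ) (hδ1 : δ ≤ 1) {i : ℕ} (N : Finset (Fin (2 ^ i))) :
    ((2 ^ i : ℕ) : ℝ) * δ - ∑ l ∈ N, bhattacharyya (bec δ) i l ≤
      equivocation (erasureWiretap δ) i (univ \ N) N := by
  classical
  -- The exponent is `e - a`; the pattern probability is common to both sides, leaving the count of
  -- consistent random bits.
  have h1 := le_condEntropy (messageObservationLaw_nonneg hδ0 hδ1 N)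
    (fun z => ((erased z).card : ℝ) - #{l ∈ N | Ambiguous i l z}) fun u z => by
      rw [sum_messageObservationLaw, outputLaw_eq, messageObservationLaw_eq_card, neg_sub,
        Real.rpow_sub two_pos, Real.rpow_natCast, Real.rpow_natCast, mul_assoc, mul_assoc,
        mul_div_cancel₀ _ (by positivity)]
      have := patternProb_nonneg hδ0 hδ1 z
      gcongr
      exact_mod_cast card_consistent_merge_le N u z
  refine le_trans ?_ h1
  simp_rw [sum_messageObservationLaw, mul_sub, sum_sub_distrib, sum_outputLaw_mul_erased]
  gcongr
  simp_rw [card_filter, Nat.cast_sum, mul_sum]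
  rw [sum_comm]
  refine sum_le_sum fun l _ => ?_
  simpa using sum_outputLaw_ambiguous_le hδ0 hδ1 i l

end PolarWiretap

theorem mainTheorem3 (δ : ℝ) (hδ0 : 0 ≤ δ) (hδ1 : δ ≤ 1) :
    ∃ c : ℝ, 0 < c ∧
      ∀ β : ℝ, 0 < β → β < 1 / 2 →
        ∀ (i n : ℕ), n = 2 ^ i →
          ∀ N : Finset (Fin (2 ^ i)),
            (∀ l ∈ N,
              PolarWiretap.bhattacharyya
                  (PolarWiretap.eavesdropper (PolarWiretap.erasureWiretap δ)) i l ≤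
                (2 : ℝ) ^ (-((n : ℝ) ^ β))) →
            (n : ℝ) * δ * (1 - c * (2 : ℝ) ^ (-((n : ℝ) ^ β))) ≤
              PolarWiretap.equivocation (PolarWiretap.erasureWiretap δ) i
                (Finset.univ \ N) N := by
  -- At `δ = 0` the choice `c = 1 / δ` is unavailable, but the bound is 0 and any `c` serves.
  rcases hδ0.eq_or_lt with rfl | hδ
  · refine ⟨1, one_pos, fun β _ _ i n _ N _ => ?_⟩
    rw [mul_zero, zero_mul]
    exact PolarWiretap.condEntropy_nonneg
      (PolarWiretap.messageObservationLaw_nonneg le_rfl zero_le_one N)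
  · refine ⟨1 / δ, by positivity, fun β _ _ i n hn N hN => ?_⟩
    rw [PolarWiretap.eavesdropper_erasureWiretap] at hN
    refine le_trans ?_ (PolarWiretap.le_equivocation hδ0 hδ1 N)
    set ε : ℝ := (2 : ℝ) ^ (-((n : ℝ) ^ β))
    have hε : 0 ≤ ε := by positivity
    have h1 : ∑ l ∈ N, PolarWiretap.bhattacharyya (PolarWiretap.bec δ) i l ≤ n * ε := by
      refine (Finset.sum_le_card_nsmul N _ ε hN).trans ?_
      rw [nsmul_eq_mul]
      have hcard : N.card ≤ n := by simpa [hn] using Finset.card_le_univ N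
      gcongr
    have h2 : (n : ℝ) * δ * (1 - 1 / δ * ε) = n * δ - n * ε := by
      field_simp
    have h3 : ((2 ^ i : ℕ) : ℝ) = n := by rw [hn]
    rw [h2, h3]
    linarith
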